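/- Let $\pi$ be a group of order $2$ acting by automorphisms on a finitely generated free abelian group $N$, and let $H_2(N)=H_2(N,\mathbb Z)$ with the induced $\pi$-action. For a $\pi$-module $M$, regarded as an $N\rtimes\pi$-module on which $N$ acts trivially, let $$d_2^{0,2}\colon H^2(N,M)^{\pi}\to H^2(\pi,H^1(N,M))$$ be the differential on the second page of the Lyndon–Hochschild–Serre spectral sequence $E_2^{p,q}=H^p(\pi,H^q(N,M))\Rightarrow H^{p+q}(N\rtimes\pi,M)$. Let $\iota\in H^2(N,H_2(N))^{\pi}$ be the class corresponding to the identity under the universal coefficient isomorphism $H^2(N,H_2(N))=\operatorname{Hom}(H_2(N),H_2(N))$, and let $$v_2(N):=d_2^{0,2}(\iota)\in H^2(\pi,H^1(N,H_2(N)))$$ be the characteristic class of $N$. Then $v_2(N)=0$. Moreover, for every $\pi$-module $M$ the differential $d_2^{0,2}\colon H^2(N,M)^{\pi}\to H^2(\pi,H^1(N,M))$ vanishes. -/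

import Mathlib

/-! Notation. `N` is an abelian group, written multiplicatively, `π` is a group acting on `N`
through `φ : π →* MulAut N`, and `N ⋊[φ] π` is the semidirect product. `Rep k G` is the category of
modules over `k[G]`; the case of interest is `k = ℤ`, and then these are the `G`-modules. -/

noncomputable section

namespace LHS

open CategoryTheory

universe u

variable {k N π : Type u} [CommRing k] [CommGroup N] [Group π] (φ : π →* MulAut N)

/-! ### Conjugation action of `π` on the cochains and on the cohomology of `N` -/

section Conjugation

variable (A : Rep.{u} k (N ⋊[φ] π))

/-- The restriction to `N` of a module over `N ⋊[φ] π`. -/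
abbrev resN : Rep k N := Rep.res (SemidirectProduct.inl : N →* N ⋊[φ] π) A

/-- The automorphism `n ↦ s⁻¹ · n` of `N`, as a monoid homomorphism. -/
abbrev invAct (s : π) : N →* N := (φ s⁻¹).toMonoidHom

/-- Multiplication by `s` on `A`; it is compatible with the automorphism `n ↦ s⁻¹ · n` of `N`. -/
def conjHom (s : π) : Rep.res (invAct φ s) (resN φ A) ⟶ resN φ A :=
  Rep.ofHom ⟨A.ρ (SemidirectProduct.inr s), fun n => by
    change A.ρ _ * A.ρ _ = A.ρ _ * A.ρ _
    rw [← map_mul, ← map_mul]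
    congr 1
    ext <;> simp⟩

/-- The `π`-module structure on `H^q(N, A)`: on cochains,
`(s • f) (n₁, …, n_q) = s • f (s⁻¹ · n₁, …, s⁻¹ · n_q)`. -/
def conjRep (q : ℕ) : Representation k π (groupCohomology (resN φ A) q) where
  toFun s := (groupCohomology.map (invAct φ s) (conjHom φ A s) q).hom
  map_one' := by
    have h : groupCohomology.map (invAct φ 1) (conjHom φ A 1) q = 𝟙 _ := by
      rw [← groupCohomology.map_id]
      refine groupCohomology.map_congr ?_ ?_ q
      · ext; simp
      · refine LinearMap.ext fun x => ?_
        change A.ρ _ x = x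
        simp
    rw [h]
    rfl
  map_mul' s t := by
    rw [Module.End.mul_eq_comp, ← ModuleCat.hom_comp, ← groupCohomology.map_comp]
    congr 1
    refine groupCohomology.map_congr ?_ ?_ q
    · ext; simp
    · refine LinearMap.ext fun x => ?_
      change A.ρ _ x = A.ρ _ (A.ρ _ x)
      simp

/-- `H^q(N, A)` as a `π`-module. -/
abbrev HN (q : ℕ) : Rep k π := Rep.of (conjRep φ A q)

/-- The action of `s : π` on the inhomogeneous `1`-cochains of `N`. -/
def conj₁ (s : π) (f : N → A) : N → A :=
  fun n => A.ρ (SemidirectProduct.inr s) (f (φ s⁻¹ n))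

/-- The action of `s : π` on the inhomogeneous `2`-cochains of `N`. -/
def conj₂ (s : π) (f : N × N → A) : N × N → A :=
  fun n => A.ρ (SemidirectProduct.inr s) (f (φ s⁻¹ n.1, φ s⁻¹ n.2))


variable {φ A} in
lemma conj₁_add (s : π) (f g : N → A) : conj₁ φ A s (f + g) = conj₁ φ A s f + conj₁ φ A s g := by
  funext n; simp [conj₁]

variable {φ A} in
lemma conj₁_sub (s : π) (f g : N → A) : conj₁ φ A s (f - g) = conj₁ φ A s f - conj₁ φ A s g := by
  funext n; simp [conj₁]

variable {φ A} in
lemma conj₂_sub (s : π) (f g : N × N → A) :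
    conj₂ φ A s (f - g) = conj₂ φ A s f - conj₂ φ A s g := by
  funext n; simp [conj₂]

variable {φ A} in
lemma conj₂_add (s : π) (f g : N × N → A) :
    conj₂ φ A s (f + g) = conj₂ φ A s f + conj₂ φ A s g := by
  funext n; simp [conj₂]

variable {φ A} in
lemma conj₁_mul (s t : π) (f : N → A) : conj₁ φ A (s * t) f = conj₁ φ A s (conj₁ φ A t f) := by
  funext n; simp [conj₁]

variable {φ A} in
lemma conj₂_mul (s t : π) (f : N × N → A) :
    conj₂ φ A (s * t) f = conj₂ φ A s (conj₂ φ A t f) := by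
  funext n; simp [conj₂]

variable {φ A} in
lemma d₁₂_conj₁ (s : π) (f : N → A) :
    groupCohomology.d₁₂ (resN φ A) (conj₁ φ A s f) =
      conj₂ φ A s (groupCohomology.d₁₂ (resN φ A) f) :=
  (congrArg (fun h => h.hom f)
    (groupCohomology.mapShortComplexH1.{u, u} (invAct φ s) (conjHom φ A s)).comm₂₃)

variable {φ A} in
lemma conj₁_mem (s : π) (f : groupCohomology.cocycles₁ (resN φ A)) :
    conj₁ φ A s f ∈ groupCohomology.cocycles₁ (resN φ A) :=
  (groupCohomology.mapCocycles₁.{u, u} (invAct φ s) (conjHom φ A s) f).2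

variable {φ A} in
lemma conj₂_mem (s : π) (f : groupCohomology.cocycles₂ (resN φ A)) :
    conj₂ φ A s f ∈ groupCohomology.cocycles₂ (resN φ A) :=
  (groupCohomology.mapCocycles₂ (invAct φ s) (conjHom φ A s) f).2

variable {φ A} in
lemma conjRep_H1π (s : π) (f : groupCohomology.cocycles₁ (resN φ A)) :
    conjRep φ A 1 s (groupCohomology.H1π _ f) = groupCohomology.H1π _ ⟨_, conj₁_mem s f⟩ :=
  groupCohomology.H1π_comp_map_apply (invAct φ s) (conjHom φ A s) f

variable {φ A} in
lemma conjRep_H2π (s : π) (f : groupCohomology.cocycles₂ (resN φ A)) :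
    conjRep φ A 2 s (groupCohomology.H2π _ f) = groupCohomology.H2π _ ⟨_, conj₂_mem s f⟩ :=
  groupCohomology.H2π_comp_map_apply (invAct φ s) (conjHom φ A s) f

end Conjugation

/-! ### The differential `d₂^{0,2}` -/

section Differential

variable (A : Rep.{u} k (N ⋊[φ] π))

/-- The graph of `d₂^{0,2}` for the spectral sequence of the double complex
`K^{p,q} = C^p(π, C^q(N, A))`, whose second page is `E₂^{p,q} = H^p(π, H^q(N, A))`.
The class `x` of `z ∈ K^{0,2}` is sent to the class `y` of `δ a ∈ K^{2,1}`, where `a ∈ K^{1,1}`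
is such that `d a = δ z`; here `d` and `δ` are the differentials of cochains of `N` and of `π`. -/
def IsD2 (x : groupCohomology (resN φ A) 2) (y : groupCohomology (HN φ A 1) 2) : Prop :=
  ∃ (z : groupCohomology.cocycles₂ (resN φ A)) (a : π → N → A)
    (b : π → π → groupCohomology.cocycles₁ (resN φ A))
    (c : groupCohomology.cocycles₂ (HN φ A 1)),
    groupCohomology.H2π _ z = x ∧
    (∀ s, groupCohomology.d₁₂ (resN φ A) (a s) = conj₂ φ A s z - z) ∧
    (∀ s t, (b s t : N → A) = conj₁ φ A s (a t) - a (s * t) + a s) ∧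
    (∀ s t, c (s, t) = groupCohomology.H1π _ (b s t)) ∧
    groupCohomology.H2π _ c = y

variable {φ A}

lemma IsD2.exists {x : groupCohomology (resN φ A) 2} (hx : x ∈ (conjRep φ A 2).invariants) :
    ∃ y, IsD2 φ A x y := by
  induction x using groupCohomology.H2_induction_on with | h z => ?_
  have h1 : ∀ s, ∃ f : N → A, groupCohomology.d₁₂ (resN φ A) f = conj₂ φ A s z - z := by
    intro s
    have h := hx s
    rw [conjRep_H2π, groupCohomology.H2π_eq_iff] at h
    obtain ⟨f, hf⟩ := h
    exact ⟨f, hf⟩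
  choose a ha using h1
  have hb : ∀ s t, conj₁ φ A s (a t) - a (s * t) + a s ∈
      groupCohomology.cocycles₁ (resN φ A) := by
    intro s t
    change groupCohomology.d₁₂ (resN φ A) (conj₁ φ A s (a t) - a (s * t) + a s) = 0
    rw [map_add, map_sub, d₁₂_conj₁, ha, ha, ha, conj₂_sub, conj₂_mul]
    abel
  let b : π → π → groupCohomology.cocycles₁ (resN φ A) := fun s t => ⟨_, hb s t⟩
  have hc : (fun p : π × π => groupCohomology.H1π (resN φ A) (b p.1 p.2)) ∈
      groupCohomology.cocycles₂ (HN φ A 1) := by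
    rw [groupCohomology.mem_cocycles₂_iff]
    intro s t r
    change _ = conjRep φ A 1 s _ + _
    rw [conjRep_H1π, ← map_add, ← map_add]
    congr 1
    refine Subtype.ext ?_
    change (conj₁ φ A (s * t) (a r) - a (s * t * r) + a (s * t)) +
      (conj₁ φ A s (a t) - a (s * t) + a s) =
      conj₁ φ A s (conj₁ φ A t (a r) - a (t * r) + a t) +
      (conj₁ φ A s (a (t * r)) - a (s * (t * r)) + a s)
    rw [conj₁_add, conj₁_sub, conj₁_mul, mul_assoc]
    abel
  exact ⟨_, z, a, b, ⟨_, hc⟩, rfl, ha, fun _ _ => rfl, fun _ _ => rfl, rfl⟩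

lemma IsD2.add {x x' : groupCohomology (resN φ A) 2} {y y' : groupCohomology (HN φ A 1) 2}
    (h : IsD2 φ A x y) (h' : IsD2 φ A x' y') : IsD2 φ A (x + x') (y + y') := by
  obtain ⟨z, a, b, c, rfl, ha, hb, hc, rfl⟩ := h
  obtain ⟨z', a', b', c', rfl, ha', hb', hc', rfl⟩ := h'
  refine ⟨z + z', fun s => a s + a' s, fun s t => b s t + b' s t, c + c', map_add _ _ _,
    fun s => ?_, fun s t => ?_, fun s t => ?_, map_add _ _ _⟩
  · rw [map_add, ha, ha']
    change _ = conj₂ φ A s ((z : N × N → A) + (z' : N × N → A)) - (z + z' : N × N → A)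
    rw [conj₂_add]
    abel
  · change (b s t + b' s t : N → A) = _
    rw [hb, hb', conj₁_add]
    change _ = conj₁ φ A s (a t) + conj₁ φ A s (a' t) - (a (s * t) + a' (s * t)) + (a s + a' s)
    abel
  · rw [map_add, ← hc, ← hc']
    rfl

lemma IsD2.smul (r : k) {x : groupCohomology (resN φ A) 2} {y : groupCohomology (HN φ A 1) 2}
    (h : IsD2 φ A x y) : IsD2 φ A (r • x) (r • y) := by
  obtain ⟨z, a, b, c, rfl, ha, hb, hc, rfl⟩ := h
  refine ⟨r • z, fun s => r • a s, fun s t => r • b s t, r • c, map_smul _ _ _,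
    fun s => ?_, fun s t => ?_, fun s t => ?_, map_smul _ _ _⟩
  · rw [map_smul, ha, smul_sub]
    congr 1
    funext n
    exact (map_smul (A.ρ _) r _).symm
  · change r • (b s t : N → A) = _
    rw [hb, smul_add, smul_sub]
    congr 2
    funext n
    exact (map_smul (A.ρ _) r _).symm
  · rw [map_smul, ← hc]
    rfl

lemma IsD2.eq_zero {y : groupCohomology (HN φ A 1) 2} (h : IsD2 φ A 0 y) : y = 0 := by
  obtain ⟨z, a, b, c, hz, ha, hb, hc, rfl⟩ := h
  rw [groupCohomology.H2π_eq_zero_iff] at hz ⊢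
  obtain ⟨e, he⟩ := hz
  replace he : groupCohomology.d₁₂ (resN φ A) e = (z : N × N → A) := he
  have hw : ∀ s, a s - (conj₁ φ A s e - e) ∈ groupCohomology.cocycles₁ (resN φ A) := by
    intro s
    change groupCohomology.d₁₂ (resN φ A) (a s - (conj₁ φ A s e - e)) = 0
    rw [map_sub, map_sub, d₁₂_conj₁, ha, he]
    abel
  refine ⟨fun s => groupCohomology.H1π (resN φ A) ⟨_, hw s⟩, ?_⟩
  funext p
  obtain ⟨s, t⟩ := p
  rw [hc]
  change conjRep φ A 1 s (groupCohomology.H1π (resN φ A) ⟨_, hw t⟩) -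
    groupCohomology.H1π (resN φ A) ⟨_, hw (s * t)⟩ + groupCohomology.H1π (resN φ A) ⟨_, hw s⟩ = _
  rw [conjRep_H1π, ← map_sub, ← map_add]
  congr 1
  refine Subtype.ext (Eq.trans ?_ (hb s t).symm)
  change conj₁ φ A s (a t - (conj₁ φ A t e - e)) - (a (s * t) - (conj₁ φ A (s * t) e - e)) +
    (a s - (conj₁ φ A s e - e)) = _
  rw [conj₁_sub, conj₁_sub, conj₁_mul]
  abel

lemma IsD2.unique {x : groupCohomology (resN φ A) 2} {y y' : groupCohomology (HN φ A 1) 2}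
    (h : IsD2 φ A x y) (h' : IsD2 φ A x y') : y = y' := by
  have h0 : IsD2 φ A 0 (y - y') := by
    simpa [sub_eq_add_neg] using! h.add (h'.smul (-1))
  exact sub_eq_zero.1 h0.eq_zero

variable (φ A)

/-- The differential `d₂^{0,2} : H²(N, A)^π → H²(π, H¹(N, A))` of the
Lyndon-Hochschild-Serre spectral sequence of the split extension `N ⋊[φ] π` with coefficients `A`.
The inhomogeneous bar resolution of `N`, with its action of `π`, is a resolution of the trivial
module over `N ⋊[φ] π` which is free over `N`, so the spectral sequence is that of the double
complex `C^p(π, C^q(N, A))`. -/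
def d2 : (conjRep φ A 2).invariants →ₗ[k] groupCohomology (HN φ A 1) 2 where
  toFun x := (IsD2.exists x.2).choose
  map_add' x y := ((IsD2.exists (x + y).2).choose_spec).unique
    ((IsD2.exists x.2).choose_spec.add (IsD2.exists y.2).choose_spec)
  map_smul' r x := ((IsD2.exists (r • x).2).choose_spec).unique
    ((IsD2.exists x.2).choose_spec.smul r)

lemma isD2_iff (x : (conjRep φ A 2).invariants) (y : groupCohomology (HN φ A 1) 2) :
    IsD2 φ A x y ↔ d2 φ A x = y :=
  ⟨fun h => (IsD2.exists x.2).choose_spec.unique h, fun h => h ▸ (IsD2.exists x.2).choose_spec⟩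

end Differential

/-! ### `H₂(N)` and the universal coefficient isomorphism `H²(N, B) = Hom(H₂(N), B)` -/

section UniversalCoefficients

variable (k N) in
/-- The trivial `N`-module `k`. -/
abbrev triv : Rep.{u} k N := Rep.trivial k N k

variable (k N) in
/-- The second homology group `H₂(N) = H₂(N, k)`. -/
abbrev homology₂ : ModuleCat.{u} k := groupHomology (triv k N) 2

/-- The factorization of a linear map `g` through a surjective linear map `p`. -/
def descend {M P Q : Type u} [AddCommGroup M] [AddCommGroup P] [AddCommGroup Q] [Module k M]
    [Module k P] [Module k Q] (p : M →ₗ[k] P) (hp : Function.Surjective p) (g : M →ₗ[k] Q)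
    (h : LinearMap.ker p ≤ LinearMap.ker g) : P →ₗ[k] Q :=
  Submodule.liftQ _ g h ∘ₗ (p.quotKerEquivOfSurjective hp).symm.toLinearMap

lemma descend_apply {M P Q : Type u} [AddCommGroup M] [AddCommGroup P] [AddCommGroup Q]
    [Module k M] [Module k P] [Module k Q] (p : M →ₗ[k] P) (hp : Function.Surjective p)
    (g : M →ₗ[k] Q) (h : LinearMap.ker p ≤ LinearMap.ker g) (m : M) :
    descend p hp g h (p m) = g m := by
  have h' : (p.quotKerEquivOfSurjective hp).symm (p m) = Submodule.Quotient.mk m := by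
    rw [LinearEquiv.symm_apply_eq]
    rfl
  rw [descend, LinearMap.comp_apply, LinearEquiv.coe_coe, h']
  rfl

lemma homology_H2π_surjective (A : Rep.{u} k N) :
    Function.Surjective (groupHomology.H2π A).hom :=
  fun x => groupHomology.H2_induction_on x fun c => ⟨c, rfl⟩

lemma cohomology_H2π_surjective (A : Rep.{u} k N) :
    Function.Surjective (groupCohomology.H2π A).hom :=
  fun x => groupCohomology.H2_induction_on x fun c => ⟨c, rfl⟩

section

variable (B : Rep.{u} k N) [B.IsTrivial]

lemma pairing_boundary₂ (e : N → B) (c : N × N →₀ k) :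
    Finsupp.linearCombination k (groupCohomology.d₁₂ B e) c =
      Finsupp.linearCombination k e (groupHomology.d₂₁ (triv k N) c) := by
  induction c using Finsupp.induction_linear with
  | zero => simp only [map_zero]
  | add c c' h h' => simp only [map_add, h, h']
  | single g r =>
    rw [groupHomology.d₂₁_single]
    simp only [map_add, map_sub, Finsupp.linearCombination_single]
    simp [smul_add, smul_sub]

lemma pairing_boundary₃ (f : N × N → B) (c : N × N × N →₀ k) :
    Finsupp.linearCombination k (groupCohomology.d₂₃ B f) c =
      Finsupp.linearCombination k f (groupHomology.d₃₂ (triv k N) c) := by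
  induction c using Finsupp.induction_linear with
  | zero => simp only [map_zero]
  | add c c' h h' => simp only [map_add, h, h']
  | single g r =>
    rw [groupHomology.d₃₂_single]
    simp only [map_add, map_sub, Finsupp.linearCombination_single]
    simp [smul_add, smul_sub]

/-- Evaluation of a `2`-cocycle on the second homology:
`[∑ rᵢ (mᵢ, nᵢ)] ↦ ∑ rᵢ f (mᵢ, nᵢ)`. -/
def evalCocycle (f : groupCohomology.cocycles₂ B) : homology₂ k N →ₗ[k] B :=
  descend (groupHomology.H2π (triv k N)).hom (homology_H2π_surjective _)
    (Finsupp.linearCombination k (f : N × N → B) ∘ₗ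
      (groupHomology.cycles₂ (triv k N)).subtype) (by
    intro c hc
    obtain ⟨e, he⟩ := (groupHomology.H2π_eq_zero_iff c).1 hc
    replace he : groupHomology.d₃₂ (triv k N) e = c.1 := he
    change Finsupp.linearCombination k (f : N × N → B) c.1 = 0
    rw [← he, ← pairing_boundary₃, groupCohomology.cocycles₂.d₂₃_apply]
    exact LinearMap.congr_fun (Finsupp.linearCombination_zero (N × N × N) B k) e)

variable {B} in
lemma evalCocycle_H2π (f : groupCohomology.cocycles₂ B)
    (c : groupHomology.cycles₂ (triv k N)) :
    evalCocycle B f (groupHomology.H2π _ c) = Finsupp.linearCombination k (f : N × N → B) c.1 :=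
  descend_apply _ _ _ _ c

/-- The evaluation map `H²(N, B) → Hom(H₂(N), B)`, for a module `B` with trivial action. -/
def eval : groupCohomology B 2 →ₗ[k] (homology₂ k N →ₗ[k] B) :=
  descend (groupCohomology.H2π B).hom (cohomology_H2π_surjective _)
    { toFun := evalCocycle B
      map_add' := fun f g => LinearMap.ext fun x => by
        induction x using groupHomology.H2_induction_on with | h c => ?_
        rw [LinearMap.add_apply, evalCocycle_H2π, evalCocycle_H2π, evalCocycle_H2π]
        exact (LinearMap.congr_fun (map_add (Finsupp.lift B k (N × N))
          (f : N × N → B) (g : N × N → B)) c.1)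
      map_smul' := fun r f => LinearMap.ext fun x => by
        induction x using groupHomology.H2_induction_on with | h c => ?_
        rw [LinearMap.smul_apply, evalCocycle_H2π, evalCocycle_H2π]
        change Finsupp.linearCombination k (r • (f : N × N → B)) c.1 = _
        simp only [Finsupp.linearCombination_apply, Finsupp.sum, Finset.smul_sum, RingHom.id_apply]
        exact Finset.sum_congr rfl fun g _ => smul_comm _ _ _ } (by
    intro f hf
    obtain ⟨e, he⟩ := (groupCohomology.H2π_eq_zero_iff f).1 hf
    replace he : groupCohomology.d₁₂ B e = (f : N × N → B) := he
    refine LinearMap.ext fun x => ?_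
    induction x using groupHomology.H2_induction_on with | h c => ?_
    change evalCocycle B f _ = 0
    have hc : groupHomology.d₂₁ (triv k N) c.1 = 0 := c.2
    rw [evalCocycle_H2π, ← he, pairing_boundary₂, hc, map_zero])

variable {B} in
lemma eval_H2π (f : groupCohomology.cocycles₂ B) (c : groupHomology.cycles₂ (triv k N)) :
    eval B (groupCohomology.H2π _ f) (groupHomology.H2π _ c) =
      Finsupp.linearCombination k (f : N × N → B) c.1 := by
  have h : eval B (groupCohomology.H2π _ f) = evalCocycle B f := descend_apply _ _ _ _ f
  rw [h, evalCocycle_H2π]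

lemma d₂₁_triv (g : N × N) (r : k) : groupHomology.d₂₁ (triv k N) (Finsupp.single g r) =
    (Finsupp.single g.2 r - Finsupp.single (g.1 * g.2) r + Finsupp.single g.1 r : N →₀ k) :=
  groupHomology.d₂₁_single (A := triv k N) g r

variable (k N) in
lemma exists_section [Module.Free ℤ (Additive N)] :
    ∃ τ : (N →₀ k) →ₗ[k] (N × N →₀ k), ∀ c : N × N →₀ k,
      groupHomology.d₂₁ (triv k N) (τ (groupHomology.d₂₁ (triv k N) c)) =
        groupHomology.d₂₁ (triv k N) c := by
  let R := LinearMap.range (groupHomology.d₂₁ (triv k N)).hom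
  let q : (N →₀ k) →+ (N →₀ k) ⧸ R := R.mkQ.toAddMonoidHom
  have hq : Function.Surjective q.toIntLinearMap := Submodule.mkQ_surjective R
  have hmul : ∀ m n : N, q (Finsupp.single (m * n) 1) =
      q (Finsupp.single m 1) + q (Finsupp.single n 1) := by
    intro m n
    rw [← map_add]
    refine (Submodule.Quotient.eq R).2 ⟨-Finsupp.single (m, n) 1, ?_⟩
    change groupHomology.d₂₁ (triv k N) (-Finsupp.single (m, n) 1) = _
    rw [map_neg, d₂₁_triv]
    abel
  let u : Additive N →+ (N →₀ k) ⧸ R :=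
    AddMonoidHom.mk' (fun n => q (Finsupp.single n.toMul 1)) fun m n => hmul _ _
  obtain ⟨σ, hσ⟩ := Module.projective_lifting_property q.toIntLinearMap u.toIntLinearMap hq
  have hL : ∀ n : N, ∃ c : N × N →₀ k, groupHomology.d₂₁ (triv k N) c =
      Finsupp.single n 1 - σ (Additive.ofMul n) := by
    intro n
    have h : q (σ (Additive.ofMul n)) = q (Finsupp.single n 1) :=
      LinearMap.congr_fun hσ (Additive.ofMul n)
    exact (Submodule.Quotient.eq R).1 h.symm
  choose t ht using hL
  have key : ∀ a : N →₀ k, groupHomology.d₂₁ (triv k N) (Finsupp.linearCombination k t a) =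
      a - Finsupp.linearCombination k (fun n => σ (Additive.ofMul n)) a := by
    intro a
    induction a using Finsupp.induction_linear with
    | zero => simp only [map_zero, sub_zero]
    | add a a' h h' => simp only [map_add, h, h']; abel
    | single n r =>
      rw [Finsupp.linearCombination_single, Finsupp.linearCombination_single, map_smul, ht,
        smul_sub, Finsupp.smul_single, smul_eq_mul, mul_one]
  refine ⟨Finsupp.linearCombination k t, fun c => ?_⟩
  rw [key, sub_eq_self]
  induction c using Finsupp.induction_linear with
  | zero => simp only [map_zero]
  | add c c' h h' => simp only [map_add, h, h', add_zero]
  | single g r =>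
    rw [d₂₁_triv]
    simp only [map_add, map_sub, Finsupp.linearCombination_single, ofMul_mul]
    rw [smul_add]
    abel

lemma eval_bijective [Module.Free ℤ (Additive N)] : Function.Bijective (eval B) := by
  obtain ⟨τ, hτ⟩ := exists_section k N
  have hmem : ∀ c : N × N →₀ k, c - τ (groupHomology.d₂₁ (triv k N) c) ∈
      groupHomology.cycles₂ (triv k N) := by
    intro c
    change groupHomology.d₂₁ (triv k N) (c - τ (groupHomology.d₂₁ (triv k N) c)) = 0
    rw [map_sub, hτ, sub_self]
  constructor
  · rw [injective_iff_map_eq_zero]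
    intro x hx
    induction x using groupCohomology.H2_induction_on with | h f => ?_
    rw [groupCohomology.H2π_eq_zero_iff]
    refine ⟨fun n => Finsupp.linearCombination k (f : N × N → B) (τ (Finsupp.single n 1)), ?_⟩
    funext g
    have h1 := pairing_boundary₂ B (fun n =>
      Finsupp.linearCombination k (f : N × N → B) (τ (Finsupp.single n 1))) (Finsupp.single g 1)
    rw [Finsupp.linearCombination_single, one_smul] at h1
    refine h1.trans ?_
    have h2 : ∀ a : N →₀ k, Finsupp.linearCombination k (fun n =>
        Finsupp.linearCombination k (f : N × N → B) (τ (Finsupp.single n 1))) a =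
        Finsupp.linearCombination k (f : N × N → B) (τ a) := by
      intro a
      induction a using Finsupp.induction_linear with
      | zero => simp only [map_zero]
      | add a a' h h' => simp only [map_add, h, h']
      | single n r =>
        rw [Finsupp.linearCombination_single, ← map_smul, ← map_smul, Finsupp.smul_single,
          smul_eq_mul, mul_one]
    rw [h2]
    have h3 := eval_H2π f ⟨_, hmem (Finsupp.single g 1)⟩
    rw [hx, LinearMap.zero_apply, map_sub, Finsupp.linearCombination_single, one_smul] at h3
    exact (sub_eq_zero.1 h3.symm).symm
  · intro h
    let r : (N × N →₀ k) →ₗ[k] groupHomology.cycles₂ (triv k N) :=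
      { toFun := fun c => ⟨_, hmem c⟩
        map_add' := fun c c' => Subtype.ext (by
          change (c + c') - τ (groupHomology.d₂₁ (triv k N) (c + c')) =
            (c - τ (groupHomology.d₂₁ (triv k N) c)) + (c' - τ (groupHomology.d₂₁ (triv k N) c'))
          rw [map_add, map_add, add_sub_add_comm])
        map_smul' := fun r c => Subtype.ext (by
          change r • c - τ (groupHomology.d₂₁ (triv k N) (r • c)) =
            r • (c - τ (groupHomology.d₂₁ (triv k N) c))
          rw [map_smul, map_smul, smul_sub]) }
    let F : (N × N →₀ k) →ₗ[k] B := h ∘ₗ (groupHomology.H2π (triv k N)).hom ∘ₗ r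
    have hF : ∀ c, Finsupp.linearCombination k (fun g => F (Finsupp.single g 1)) c = F c := by
      intro c
      induction c using Finsupp.induction_linear with
      | zero => simp only [map_zero]
      | add a a' h h' => simp only [map_add, h, h']
      | single n r =>
        rw [Finsupp.linearCombination_single, ← map_smul, Finsupp.smul_single,
          smul_eq_mul, mul_one]
    have hr : ∀ c : groupHomology.cycles₂ (triv k N), r c.1 = c := by
      intro c
      refine Subtype.ext ?_
      have hc : groupHomology.d₂₁ (triv k N) c.1 = 0 := c.2
      change c.1 - τ (groupHomology.d₂₁ (triv k N) c.1) = c.1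
      rw [hc, map_zero, sub_zero]
    have hf : (fun g => F (Finsupp.single g 1)) ∈ groupCohomology.cocycles₂ B := by
      change groupCohomology.d₂₃ B _ = 0
      funext g
      have h1 := pairing_boundary₃ B (fun g => F (Finsupp.single g 1)) (Finsupp.single g 1)
      rw [Finsupp.linearCombination_single, one_smul, hF] at h1
      refine h1.trans ?_
      let c : groupHomology.cycles₂ (triv k N) :=
        ⟨_, groupHomology.d₃₂_apply_mem_cycles₂ (Finsupp.single g 1)⟩
      have h2 : groupHomology.H2π (triv k N) c = 0 :=
        (groupHomology.H2π_eq_zero_iff c).2 ⟨_, rfl⟩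
      change h (groupHomology.H2π (triv k N) (r c.1)) = 0
      rw [hr, h2, map_zero]
    refine ⟨groupCohomology.H2π B ⟨_, hf⟩, LinearMap.ext fun x => ?_⟩
    induction x using groupHomology.H2_induction_on with | h c => ?_
    rw [eval_H2π]
    refine (hF c.1).trans ?_
    change h (groupHomology.H2π (triv k N) (r c.1)) = _
    rw [hr]

/-- The universal coefficient isomorphism `H²(N, B) = Hom(H₂(N), B)`, `x ↦ eval x`, for a free
abelian group `N` and a module `B` with trivial action of `N`. -/
def uct [Module.Free ℤ (Additive N)] : groupCohomology B 2 ≃ₗ[k] (homology₂ k N →ₗ[k] B) :=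
  LinearEquiv.ofBijective (eval B) (eval_bijective B)

end

end UniversalCoefficients

/-! ### The characteristic class `v₂(N)` -/

section CharacteristicClass

variable (k)

/-- The identity of the trivial module `k`, as a morphism over the automorphism `s` of `N`. -/
def trivHom (s : π) : triv k N ⟶ Rep.res (φ s).toMonoidHom (triv k N) :=
  Rep.ofHom ⟨LinearMap.id, fun _ => rfl⟩

/-- The `π`-module structure on `H₂(N)`, by functoriality: `s • [(m, n)] = [(s · m, s · n)]`. -/
def homology₂Rep : Representation k π (homology₂ k N) where
  toFun s := (groupHomology.map (φ s).toMonoidHom (trivHom k φ s) 2).hom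
  map_one' := by
    have h : groupHomology.map (φ 1).toMonoidHom (trivHom k φ 1) 2 = 𝟙 _ := by
      rw [← groupHomology.map_id]
      refine groupHomology.map_congr ?_ ?_ 2
      · ext; simp
      · rfl
    rw [h]
    rfl
  map_mul' s t := by
    rw [Module.End.mul_eq_comp, ← ModuleCat.hom_comp, ← groupHomology.map_comp]
    congr 1
    refine groupHomology.map_congr ?_ ?_ 2
    · ext; simp
    · rfl

/-- `H₂(N)` as a `π`-module. -/
abbrev H₂N : Rep.{u} k π := Rep.of (homology₂Rep k φ)

variable {k}

/-- A `π`-module, regarded as a module over `N ⋊[φ] π` on which `N` acts trivially. -/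
abbrev inflate (M : Rep.{u} k π) : Rep.{u} k (N ⋊[φ] π) := Rep.res SemidirectProduct.rightHom M

instance inflate_isTrivial (M : Rep.{u} k π) : (resN φ (inflate φ M)).IsTrivial where
  out n := by
    change M.ρ _ = _
    rw [SemidirectProduct.rightHom_inl, map_one]
    rfl

variable {φ} in
/-- Evaluation is compatible with the actions of `π`. -/
lemma eval_conj (M : Rep.{u} k π) (s : π)
    (x : groupCohomology (resN φ (inflate φ M)) 2) (y : homology₂ k N) :
    eval (resN φ (inflate φ M)) (conjRep φ (inflate φ M) 2 s x) (homology₂Rep k φ s y) =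
      M.ρ s (eval (resN φ (inflate φ M)) x y) := by
  induction x using groupCohomology.H2_induction_on with | h f => ?_
  induction y using groupHomology.H2_induction_on with | h c => ?_
  have hc : homology₂Rep k φ s (groupHomology.H2π _ c) =
      groupHomology.H2π _ (groupHomology.mapCycles₂ (φ s).toMonoidHom (trivHom k φ s) c) :=
    groupHomology.H2π_comp_map_apply (φ s).toMonoidHom (trivHom k φ s) c
  rw [hc, conjRep_H2π, eval_H2π, eval_H2π, groupHomology.coe_mapCycles₂]
  generalize c.1 = c₀
  change Finsupp.linearCombination k (conj₂ φ (inflate φ M) s f)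
    (groupHomology.chainsMap₂ (φ s).toMonoidHom (trivHom k φ s) c₀) =
    M.ρ s (Finsupp.linearCombination k (f : N × N → M) c₀)
  clear hc
  induction c₀ using Finsupp.induction_linear with
  | zero => simp only [map_zero]
  | add c c' h h' => simp only [map_add, h, h']
  | single g r =>
    have h : groupHomology.chainsMap₂ (φ s).toMonoidHom (trivHom k φ s) (Finsupp.single g r) =
        (Finsupp.single (φ s g.1, φ s g.2) r : N × N →₀ k) := by
      rw [groupHomology.chainsMap₂]
      simp
      rfl
    rw [h, Finsupp.linearCombination_single, Finsupp.linearCombination_single, map_smul]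
    congr 1
    change M.ρ (SemidirectProduct.rightHom (SemidirectProduct.inr s))
      ((f : N × N → M) (φ s⁻¹ (φ s g.1), φ s⁻¹ (φ s g.2))) = _
    rw [SemidirectProduct.rightHom_inr]
    simp

variable (k)
variable [Module.Free ℤ (Additive N)]

/-- The class in `H²(N, H₂(N))` which corresponds to the identity under the universal coefficient
isomorphism `H²(N, H₂(N)) = Hom(H₂(N), H₂(N))`. -/
def fundamentalClass : groupCohomology (resN φ (inflate φ (H₂N k φ))) 2 :=
  haveI := inflate_isTrivial φ (H₂N k φ)
  (uct (resN φ (inflate φ (H₂N k φ)))).symm LinearMap.id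

lemma fundamentalClass_mem : fundamentalClass k φ ∈
    (conjRep φ (inflate φ (H₂N k φ)) 2).invariants := by
  have := inflate_isTrivial φ (H₂N k φ)
  intro s
  apply (uct (resN φ (inflate φ (H₂N k φ)))).injective
  refine LinearMap.ext fun y => ?_
  obtain ⟨y, rfl⟩ : ∃ y', homology₂Rep k φ s y' = y :=
    ⟨homology₂Rep k φ s⁻¹ y, by simp⟩
  have h : eval (resN φ (inflate φ (H₂N k φ))) (fundamentalClass k φ) = LinearMap.id :=
    (uct (resN φ (inflate φ (H₂N k φ)))).apply_symm_apply LinearMap.id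
  change eval (resN φ (inflate φ (H₂N k φ))) (conjRep φ (inflate φ (H₂N k φ)) 2 s
    (fundamentalClass k φ)) (homology₂Rep k φ s y) =
    eval (resN φ (inflate φ (H₂N k φ))) (fundamentalClass k φ) (homology₂Rep k φ s y)
  rw [eval_conj, h]
  rfl

/-- The characteristic class `v₂(N) ∈ H²(π, H¹(N, H₂(N)))`: the image under `d₂^{0,2}` of the
class in `H²(N, H₂(N))^π` which corresponds to the identity of `H₂(N)`. -/
def v2 : groupCohomology (HN φ (inflate φ (H₂N k φ)) 1) 2 :=
  d2 φ (inflate φ (H₂N k φ)) ⟨fundamentalClass k φ, fundamentalClass_mem k φ⟩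

end CharacteristicClass

end LHS

end

/-! The differential is computed on cochains, and the point is to choose the zigzag so well that it
ends in the zero cochain. Write `L` for the lattice `N` in additive notation.

The action of a group of order two is given by an involution, and an integral representation of it
is a sum of trivial, sign and regular representations. So `L` has a basis that the group permutes up
to signs (`exists_basis_of_involution`). This is the only place where the order of `π` matters.

Over a free abelian group a `2`-cocycle with trivial coefficients is determined up to coboundaries
by its alternating commutator form, because symmetric cocycles split
(`exists_primitive_of_symmetric`). Hence every class is represented by a bilinear form `β` that is
strictly upper triangular in the chosen basis. If the class is invariant, `s • β - β` is symmetric.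
It vanishes on the diagonal of the basis, since `β (±b j) (±b j) = 0`. It is therefore bounded by a
quadratic map `a s` which is zero at every `±b i` (`exists_quadratic_of_symmetric`).

The cochain `s • a t - a (s * t) + a s` is then additive on `L` and zero on the basis, hence zero
(`exists_cocycle_of_signed_basis`). So `d₂^{0,2}` vanishes for all coefficients inflated from `π`,
and `v₂(N)` is one of its values. -/

/-! ### Symmetric cocycles and abelian extensions -/

/-- The underlying set of the extension of `L` by `M` with factor set `-f`. -/
@[ext]
structure FactorSetExtension {L M : Type*} (f : L → L → M) where
  /-- The component in the kernel. -/
  fst : M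
  /-- The component in the quotient. -/
  snd : L

/-- The extension of `L` by `M` defined by a symmetric `2`-cocycle is an abelian group. -/
abbrev FactorSetExtension.addCommGroup {L M : Type*} [AddCommGroup L] [AddCommGroup M]
    (f : L → L → M) (hf : ∀ x y z, f (x + y) z + f x y = f y z + f x (y + z))
    (hs : ∀ x y, f x y = f y x) : AddCommGroup (FactorSetExtension f) :=
  letI : Add (FactorSetExtension f) := ⟨fun p q => ⟨p.fst + q.fst - f p.snd q.snd, p.snd + q.snd⟩⟩
  -- The cocycle is not assumed normalized, so the neutral element is shifted by `f 0 0`.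
  letI : Zero (FactorSetExtension f) := ⟨⟨f 0 0, 0⟩⟩
  letI : Neg (FactorSetExtension f) := ⟨fun p => ⟨-p.fst + f (-p.snd) p.snd + f 0 0, -p.snd⟩⟩
  have h0 : ∀ x, f 0 x = f 0 0 := fun x => by simpa using (hf 0 0 x).symm
  { AddGroup.ofLeftAxioms (G := FactorSetExtension f)
      (fun p q r => FactorSetExtension.ext
        (show p.fst + q.fst - f p.snd q.snd + r.fst - f (p.snd + q.snd) r.snd =
          p.fst + (q.fst + r.fst - f q.snd r.snd) - f p.snd (q.snd + r.snd) by
          have h := sub_eq_zero.2 (hf p.snd q.snd r.snd)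
          rw [← sub_eq_zero, ← neg_zero, ← h]
          abel) (add_assoc _ _ _))
      (fun p => FactorSetExtension.ext
        (show f 0 0 + p.fst - f 0 p.snd = p.fst by
          rw [h0 p.snd, add_sub_cancel_left]) (zero_add _))
      (fun p => FactorSetExtension.ext
        (show -p.fst + f (-p.snd) p.snd + f 0 0 + p.fst - f (-p.snd) p.snd = f 0 0 by abel)
        (neg_add_cancel _)) with
    add_comm := fun p q => FactorSetExtension.ext
        (show p.fst + q.fst - f p.snd q.snd = q.fst + p.fst - f q.snd p.snd by
          rw [hs, add_comm p.fst]) (add_comm _ _) }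

/-- A symmetric `2`-cocycle of a free abelian group is a coboundary. -/
lemma exists_primitive_of_symmetric {L M : Type*} [AddCommGroup L] [Module.Free ℤ L]
    [AddCommGroup M] (f : L → L → M)
    (hf : ∀ x y z, f (x + y) z + f x y = f y z + f x (y + z)) (hs : ∀ x y, f x y = f y x) :
    ∃ g : L → M, ∀ x y, g x + g y - g (x + y) = f x y := by
  let := FactorSetExtension.addCommGroup f hf hs
  let p : FactorSetExtension f →+ L := AddMonoidHom.mk' FactorSetExtension.snd fun _ _ => rfl
  have hp : Function.Surjective p.toIntLinearMap := fun x => ⟨⟨0, x⟩, rfl⟩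
  -- The extension splits because `L` is free. Additivity of the splitting, read in the kernel
  -- component, says that this component is a primitive of `f`.
  obtain ⟨σ, hσ⟩ := Module.projective_lifting_property p.toIntLinearMap LinearMap.id hp
  have hσ' : ∀ x, (σ x).snd = x := fun x => LinearMap.congr_fun hσ x
  refine ⟨fun x => (σ x).fst, fun x y => ?_⟩
  have h : (σ (x + y)).fst = (σ x).fst + (σ y).fst - f (σ x).snd (σ y).snd :=
    congrArg FactorSetExtension.fst (map_add σ x y)
  rw [hσ', hσ'] at h
  change (σ x).fst + (σ y).fst - (σ (x + y)).fst = f x y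
  rw [h]
  abel

/-! ### Lattices with an involution -/

/-- A lattice with an involution has a basis which is permuted up to signs. -/
lemma exists_basis_of_involution {L : Type*} [AddCommGroup L] [Module.Free ℤ L]
    [Module.Finite ℤ L] (σ : L →ₗ[ℤ] L) (hσ : ∀ x, σ (σ x) = x) :
    ∃ (n : ℕ) (b : Module.Basis (Fin n) ℤ L), ∀ i, ∃ j, σ (b i) = b j ∨ σ (b i) = -b j := by
  let P := LinearMap.ker (σ - LinearMap.id)
  let R := LinearMap.range (σ - LinearMap.id)
  have hP : ∀ x, x ∈ P ↔ σ x = x := fun x => by simp [P, sub_eq_zero]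
  -- `R` is free as a submodule of a lattice, so `L` is the direct sum of the fixed lattice `P` and
  -- `s R`. The action is then encoded by `u`, since `σ (s r) = u r - s r`.
  obtain ⟨s, hs⟩ := Module.projective_lifting_property (σ - LinearMap.id).rangeRestrict
    (LinearMap.id : R →ₗ[ℤ] R) (LinearMap.surjective_rangeRestrict _)
  have hs' : ∀ r : R, σ (s r) - s r = r := fun r =>
    congrArg Subtype.val (LinearMap.congr_fun hs r)
  let u : R →ₗ[ℤ] P := ((σ + LinearMap.id) ∘ₗ s).codRestrict P fun r => by
    rw [hP]; simp [hσ, add_comm]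
  have hu : ∀ r, (u r : L) = σ (s r) + s r := fun _ => rfl
  -- Smith normal form diagonalizes `u`: the elements `w j` and a basis of `ker u` together generate
  -- `R`, and `u (w j)` is a multiple of one basis vector of `P`.
  obtain ⟨n, bP, bU, f, a, hsnf⟩ :=
    (LinearMap.range u).smithNormalForm (Module.finBasis ℤ P)
  have hlift : ∀ j, ∃ r, u r = bU j := fun j => (bU j).2
  choose w hw using hlift
  have hw' : ∀ j, σ (s (w j)) + s (w j) = a j • (bP (f j) : L) := fun j => by
    rw [← hu, hw, hsnf]; rfl
  let bK := Module.finBasis ℤ (LinearMap.ker u)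
  -- Translating `s (w j)` by a multiple `m` of `bP (f j)` changes the coefficient `a j` by `2 * m`,
  -- so it can be reduced to its parity.
  let c : Fin n → L := fun j => s (w j) - (a j / 2) • (bP (f j) : L)
  have hbP : ∀ i, σ (bP i : L) = bP i := fun i => (hP _).1 (bP i).2
  have hc : ∀ j, σ (c j) = (a j % 2) • (bP (f j) : L) - c j := by
    intro j
    have h := hw' j
    have h2 : a j = a j % 2 + 2 * (a j / 2) := (Int.emod_add_mul_ediv (a j) 2).symm
    rw [h2, add_smul, mul_smul, two_smul] at h
    simp only [c, map_sub, map_zsmul, hbP]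
    rw [← sub_eq_zero] at h ⊢
    rw [← h]
    abel
  classical
  -- For odd `a j`, `σ (c j) = bP (f j) - c j`. Replacing `bP (f j)` by `σ (c j)` then gives a pair
  -- swapped by `σ`, a regular summand. For even `a j`, `c j` is negated and `bP (f j)` stays.
  let p : Fin (Module.finrank ℤ P) → L := fun i =>
    if h : ∃ j, f j = i ∧ a j % 2 = 1 then σ (c h.choose) else bP i
  have hp1 : ∀ j, a j % 2 = 1 → p (f j) = σ (c j) := by
    intro j hj
    have h : ∃ j', f j' = f j ∧ a j' % 2 = 1 := ⟨j, rfl, hj⟩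
    have h' : h.choose = j := f.injective h.choose_spec.1
    simp only [p, dif_pos h, h']
  have hp2 : ∀ i, (¬ ∃ j, f j = i ∧ a j % 2 = 1) → p i = bP i := fun i hi => dif_neg hi
  let v : Fin (Module.finrank ℤ P) ⊕ Fin n ⊕ Fin (Module.finrank ℤ (LinearMap.ker u)) → L :=
    Sum.elim p (Sum.elim c fun k => s (bK k))
  let S := Submodule.span ℤ (Set.range v)
  have hv : ∀ t, v t ∈ S := fun t => Submodule.subset_span ⟨t, rfl⟩
  have hcS : ∀ j, c j ∈ S := fun j => hv (.inr (.inl j))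
  have hfS : ∀ i, (bP i : L) ∈ S := by
    intro i
    by_cases h : ∃ j, f j = i ∧ a j % 2 = 1
    · obtain ⟨j, rfl, hj⟩ := h
      have h1 := hc j
      rw [hj, one_smul, ← hp1 j hj] at h1
      rw [sub_eq_iff_eq_add.1 h1.symm]
      exact S.add_mem (hv (.inl (f j))) (hcS j)
    · rw [← hp2 i h]
      exact hv (.inl i)
  have hPS : ∀ x ∈ P, x ∈ S := by
    intro x hx
    have h : (⊤ : Submodule ℤ P) ≤ S.comap P.subtype := by
      rw [← bP.span_eq, Submodule.span_le]
      rintro _ ⟨i, rfl⟩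
      exact hfS i
    exact h (x := ⟨x, hx⟩) trivial
  have hKS : LinearMap.ker u ≤ S.comap s := by
    intro x hx
    have h : (⊤ : Submodule ℤ (LinearMap.ker u)) ≤ (S.comap s).comap (LinearMap.ker u).subtype := by
      rw [← bK.span_eq, Submodule.span_le]
      rintro _ ⟨i, rfl⟩
      exact hv (.inr (.inr i))
    exact h (x := ⟨x, hx⟩) trivial
  have hRS : ∀ r, s r ∈ S := by
    have h1 : (⊤ : Submodule ℤ (LinearMap.range u)) ≤
        ((S.comap s).map u).comap (LinearMap.range u).subtype := by
      rw [← bU.span_eq, Submodule.span_le]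
      rintro _ ⟨j, rfl⟩
      refine ⟨w j, ?_, hw j⟩
      change s (w j) ∈ S
      rw [← sub_add_cancel (s (w j)) ((a j / 2) • (bP (f j) : L))]
      exact S.add_mem (hcS j) (S.smul_mem _ (hfS _))
    intro r
    obtain ⟨r', hr', h⟩ := h1 (x := ⟨u r, r, rfl⟩) trivial
    have h2 : r - r' ∈ LinearMap.ker u := by
      rw [LinearMap.mem_ker, map_sub, h]
      exact sub_self _
    rw [← sub_add_cancel r r']
    exact (S.comap s).add_mem (hKS h2) hr'
  have htop : ⊤ ≤ S := by
    intro x _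
    let r : R := ⟨σ x - x, x, rfl⟩
    rw [← sub_add_cancel x (s r)]
    refine S.add_mem (hPS _ ((hP _).2 ?_)) (hRS r)
    have h : σ (s r) - s r = σ x - x := hs' r
    rw [map_sub, sub_eq_sub_iff_sub_eq_sub, ← h]
  -- Rank and nullity for `σ - 1` and for `u` show that the spanning family has as many members as
  -- the rank of `L`. This makes it a basis with no separate proof of independence.
  have hcard : Fintype.card (Fin (Module.finrank ℤ P) ⊕ Fin n ⊕
      Fin (Module.finrank ℤ (LinearMap.ker u))) = Module.finrank ℤ L := by
    have h1 := (LinearMap.ker (σ - LinearMap.id)).finrank_quotient_add_finrank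
    have h2 := (LinearMap.ker u).finrank_quotient_add_finrank
    rw [LinearEquiv.finrank_eq (LinearMap.quotKerEquivRange _)] at h1 h2
    have h3 := Module.finrank_eq_card_basis bU
    simp only [Fintype.card_sum, Fintype.card_fin] at h3 ⊢
    change Module.finrank ℤ R + Module.finrank ℤ P = _ at h1
    omega
  let b := basisOfTopLeSpanOfCardEqFinrank v htop hcard
  have hb : ⇑b = v := coe_basisOfTopLeSpanOfCardEqFinrank _ _ _
  have key : ∀ t, ∃ t', σ (v t) = v t' ∨ σ (v t) = -v t' := by
    rintro (i | j | k)
    · by_cases h : ∃ j, f j = i ∧ a j % 2 = 1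
      · obtain ⟨j, rfl, hj⟩ := h
        refine ⟨.inr (.inl j), .inl ?_⟩
        change σ (p (f j)) = c j
        rw [hp1 j hj, hσ]
      · refine ⟨.inl i, .inl ?_⟩
        change σ (p i) = p i
        rw [hp2 i h, hbP]
    · rcases Int.emod_two_eq_zero_or_one (a j) with h | h
      · refine ⟨.inr (.inl j), .inr ?_⟩
        change σ (c j) = -c j
        rw [hc, h, zero_smul, zero_sub]
      · exact ⟨.inl (f j), .inl (hp1 j h).symm⟩
    · refine ⟨.inr (.inr k), .inr ?_⟩
      change σ (s (bK k)) = -s (bK k)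
      rw [eq_neg_iff_add_eq_zero, ← hu, show u (bK k) = 0 from (bK k).2]
      rfl
  let e := Fintype.equivFin (Fin (Module.finrank ℤ P) ⊕ Fin n ⊕
      Fin (Module.finrank ℤ (LinearMap.ker u)))
  refine ⟨_, b.reindex e, fun i => ?_⟩
  obtain ⟨t', h⟩ := key (e.symm i)
  refine ⟨e t', ?_⟩
  simpa [hb] using h

/-! ### Bilinear cocycles and quadratic primitives -/

/-- A symmetric bilinear form which vanishes on the diagonal of a basis is the polar form of a
quadratic map which vanishes on the basis up to signs. -/
lemma exists_quadratic_of_symmetric {L M : Type*} [AddCommGroup L] [AddCommGroup M] {n : ℕ}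
    (b : Module.Basis (Fin n) ℤ L) (S : L →ₗ[ℤ] L →ₗ[ℤ] M) (hS : ∀ x y, S x y = S y x)
    (h0 : ∀ i, S (b i) (b i) = 0) :
    ∃ q : L → M, (∀ x y, q x + q y - q (x + y) = S x y) ∧ ∀ i, q (b i) = 0 ∧ q (-b i) = 0 := by
  -- Keeping only the entries above the diagonal avoids dividing by two. The zero diagonal of `S` is
  -- what makes `T + T.flip = S`.
  let T : L →ₗ[ℤ] L →ₗ[ℤ] M :=
    b.constr ℤ fun i => b.constr ℤ fun j => if i < j then S (b i) (b j) else 0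
  have hT : ∀ i j, T (b i) (b j) = if i < j then S (b i) (b j) else 0 := fun i j => by
    simp only [T, Module.Basis.constr_basis]
  have hTS : T + T.flip = S := by
    refine b.ext fun i => b.ext fun j => ?_
    simp only [LinearMap.add_apply, LinearMap.flip_apply, hT]
    rcases lt_trichotomy i j with h | rfl | h
    · simp [h, h.le]
    · simp [h0]
    · simp [h, h.le, hS (b i)]
  refine ⟨fun x => -T x x, fun x y => ?_, fun i => by simp [hT]⟩
  rw [← hTS]
  simp only [map_add, LinearMap.add_apply, LinearMap.flip_apply]
  abel

/-- The commutator form of a `2`-cocycle of an abelian group is biadditive. -/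
lemma commutator_add {L M : Type*} [AddCommGroup L] [AddCommGroup M] (f : L → L → M)
    (hf : ∀ x y z, f (x + y) z + f x y = f y z + f x (y + z)) (x y z : L) :
    f (x + y) z - f z (x + y) = (f x z - f z x) + (f y z - f z y) := by
  have h1 := hf x y z
  have h2 := hf z x y
  have h3 := hf x z y
  rw [add_comm z x] at h2
  rw [add_comm z y] at h3
  grind

/-- Let a group `π` act on a lattice `L` with a basis which is permuted up to signs. A class of
`2`-cocycles of `L` which is invariant under `π` contains a cocycle `z` such that the cochains which
bound `s • z - z` can be chosen to be a `1`-cocycle in `s`. Here `ψ s` is the action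
of `s⁻¹` on `L`, and `r s` is the action of `s` on the coefficients. -/
lemma exists_cocycle_of_signed_basis {L M π : Type*} [AddCommGroup L] [AddCommGroup M] [Group π]
    {n : ℕ} (b : Module.Basis (Fin n) ℤ L) (ψ : π → L →+ L) (r : π → M →+ M)
    (hψ : ∀ s t x, ψ (s * t) x = ψ t (ψ s x)) (hr : ∀ s t x, r (s * t) x = r s (r t x))
    (hb : ∀ s i, ∃ j, ψ s (b i) = b j ∨ ψ s (b i) = -b j) (f : L → L → M)
    (hf : ∀ x y z, f (x + y) z + f x y = f y z + f x (y + z))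
    (hinv : ∀ s, ∃ h : L → M, ∀ x y, h x + h y - h (x + y) = r s (f (ψ s x) (ψ s y)) - f x y) :
    ∃ z : L → L → M, (∀ x y w, z (x + y) w + z x y = z y w + z x (y + w)) ∧
      (∃ g : L → M, ∀ x y, g x + g y - g (x + y) = z x y - f x y) ∧
      ∃ a : π → L → M,
        (∀ s x y, a s x + a s y - a s (x + y) = r s (z (ψ s x) (ψ s y)) - z x y) ∧
        ∀ s t x, r s (a t (ψ s x)) - a (s * t) x + a s x = 0 := by
  have := Module.Free.of_basis b
  let Ω : L →ₗ[ℤ] L →ₗ[ℤ] M := LinearMap.mk₂ ℤ (fun x y => f x y - f y x)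
    (commutator_add f hf)
    (fun c x y => map_zsmul (AddMonoidHom.mk' (fun x => f x y - f y x)
      fun x x' => commutator_add f hf x x' y) c x)
    (fun x y y' => by
      have := commutator_add f hf y y' x
      grind)
    (fun c x y => map_zsmul (AddMonoidHom.mk' (fun y => f x y - f y x)
      fun y y' => by
        have := commutator_add f hf y y' x
        grind) c y)
  have hΩ : ∀ x y, Ω x y = f x y - f y x := fun _ _ => rfl
  -- The upper triangular half of the alternating form `Ω` has the same commutator form as `f`, so
  -- `β - f` is a symmetric cocycle and hence a coboundary.
  let β : L →ₗ[ℤ] L →ₗ[ℤ] M :=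
    b.constr ℤ fun i => b.constr ℤ fun j => if i < j then Ω (b i) (b j) else 0
  have hβ : ∀ i j, β (b i) (b j) = if i < j then Ω (b i) (b j) else 0 := fun i j => by
    simp only [β, Module.Basis.constr_basis]
  have hβΩ : β - β.flip = Ω := by
    refine b.ext fun i => b.ext fun j => ?_
    simp only [LinearMap.sub_apply, LinearMap.flip_apply, hβ]
    rcases lt_trichotomy i j with h | rfl | h
    · simp [h, h.le]
    · simp [hΩ]
    · simp [h, h.not_gt, hΩ]
  have hcomm : ∀ x y, β x y - β y x = f x y - f y x := fun x y =>
    LinearMap.congr_fun (LinearMap.congr_fun hβΩ x) y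
  have hz : ∀ x y w, β (x + y) w + β x y = β y w + β x (y + w) := fun x y w => by
    simp only [map_add, LinearMap.add_apply]
    abel
  refine ⟨fun x y => β x y, hz, ?_, ?_⟩
  · refine exists_primitive_of_symmetric (fun x y => β x y - f x y) (fun x y w => ?_)
      fun x y => ?_
    · have h1 := hf x y w
      have h2 := hz x y w
      grind
    · have := hcomm x y
      grind
  · have hS : ∀ s, ∃ S : L →ₗ[ℤ] L →ₗ[ℤ] M, ∀ x y,
        S x y = r s (β (ψ s x) (ψ s y)) - β x y := fun s =>
      ⟨(β.compl₁₂ (ψ s).toIntLinearMap (ψ s).toIntLinearMap).compr₂ (r s).toIntLinearMap - β,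
        fun _ _ => rfl⟩
    choose S hS using hS
    -- Coboundaries on an abelian group are symmetric, so invariance of the class makes the
    -- commutator form of `f`, which is that of `β`, invariant.
    have hsymm : ∀ s x y, S s x y = S s y x := by
      intro s x y
      obtain ⟨h, hh⟩ := hinv s
      have h1 := congrArg (r s) (hcomm (ψ s x) (ψ s y))
      rw [map_sub, map_sub] at h1
      have h2 := hh x y
      have h3 := hh y x
      have h4 := hcomm x y
      rw [add_comm y x] at h3
      rw [hS, hS]
      grind
    have hdiag : ∀ s i, S s (b i) (b i) = 0 := by
      intro s i
      -- The two signs cancel in `β (-b j) (-b j)`, and `β` has zero diagonal.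
      obtain ⟨j, h | h⟩ := hb s i <;> simp [hS, h, hβ]
    choose a ha ha0 using fun s => exists_quadratic_of_symmetric b (S s) (hsymm s) (hdiag s)
    refine ⟨a, fun s x y => by rw [ha, hS], fun s t => ?_⟩
    -- The polar forms of the three terms are `r s` applied to the pullback of `S t` along `ψ s`,
    -- then `S (s * t)` and `S s`. Their alternating sum cancels, which gives additivity.
    let B : L →+ M := AddMonoidHom.mk' (fun x => r s (a t (ψ s x)) - a (s * t) x + a s x) (by
      intro x y
      have h1 := congrArg (r s) (ha t (ψ s x) (ψ s y))
      have h2 := ha (s * t) x y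
      have h3 := ha s x y
      simp only [hS, hψ, hr, map_add, map_sub] at h1 h2 h3 ⊢
      grind)
    have hB : B.toIntLinearMap = 0 := by
      refine b.ext fun i => ?_
      change r s (a t (ψ s (b i))) - a (s * t) (b i) + a s (b i) = 0
      -- Vanishing at `-b j` is needed as well as at `b j`, since a quadratic primitive need not be
      -- even or odd.
      obtain ⟨j, h | h⟩ := hb s i <;> simp [h, ha0]
    exact fun x => LinearMap.congr_fun hB x

/-! ### Vanishing of the differential -/

/-- The differential `d₂^{0,2}` vanishes if the acting group has order two, for coefficients on
which the lattice acts trivially. -/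
lemma d2_inflate_eq_zero {N π : Type} [CommGroup N] [Module.Free ℤ (Additive N)]
    [Module.Finite ℤ (Additive N)] [Group π] (hπ : Nat.card π = 2) (φ : π →* MulAut N)
    (M : Rep.{0} ℤ π) : LHS.d2 φ (LHS.inflate φ M) = 0 := by
  let ψ : π → Additive N →+ Additive N := fun s => (φ s⁻¹).toMonoidHom.toAdditive
  have hψ : ∀ s t x, ψ (s * t) x = ψ t (ψ s x) := fun s t x => by
    change Additive.ofMul (φ (s * t)⁻¹ x.toMul) = Additive.ofMul (φ t⁻¹ (φ s⁻¹ x.toMul))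
    rw [mul_inv_rev, map_mul]
    rfl
  have hψ1 : ∀ x, ψ 1 x = x := fun x => by
    change Additive.ofMul (φ 1⁻¹ x.toMul) = x
    rw [inv_one, map_one]
    rfl
  obtain ⟨σ, hσ, hσ'⟩ := (Nat.card_eq_two_iff' (1 : π)).1 hπ
  have hσσ : σ * σ = 1 := by
    by_contra h
    exact hσ (mul_eq_left.1 (hσ' _ h))
  obtain ⟨n, b, hb⟩ := exists_basis_of_involution (ψ σ).toIntLinearMap fun x => by
    change ψ σ (ψ σ x) = x
    rw [← hψ, hσσ, hψ1]
  have hb' : ∀ s i, ∃ j, ψ s (b i) = b j ∨ ψ s (b i) = -b j := by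
    intro s i
    by_cases hs : s = 1
    · exact ⟨i, .inl (by rw [hs, hψ1])⟩
    · rw [hσ' s hs]
      exact hb i
  refine DFunLike.ext _ _ fun ⟨x, hx⟩ => ?_
  -- The value of `d2` does not depend on the zigzag, so one zigzag ending at zero suffices.
  refine (LHS.isD2_iff φ (LHS.inflate φ M) ⟨x, hx⟩ 0).1 ?_
  change LHS.IsD2 φ (LHS.inflate φ M) x 0
  have htriv : ∀ (n : N) (m : M),
      (LHS.resN φ (LHS.inflate φ M)).ρ n m = m := fun n m => by
    change M.ρ (SemidirectProduct.rightHom (SemidirectProduct.inl n : N ⋊[φ] π)) m = m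
    rw [SemidirectProduct.rightHom_inl, map_one]
    rfl
  have hd : ∀ (g : N → M) (p : N × N), groupCohomology.d₁₂ (LHS.resN φ (LHS.inflate φ M)) g p =
      g p.1 + g p.2 - g (p.1 * p.2) := by
    intro g p
    change (LHS.resN φ (LHS.inflate φ M)).ρ p.1 (g p.2) - g (p.1 * p.2) + g p.1 = _
    rw [htriv]
    abel
  induction x using groupCohomology.H2_induction_on with | h f => ?_
  obtain ⟨z, hz, ⟨g, hg⟩, a, ha, ha0⟩ := exists_cocycle_of_signed_basis b ψ
    (fun s => (M.ρ s).toAddMonoidHom) hψ (fun s t m => by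
      change M.ρ (s * t) m = M.ρ s (M.ρ t m)
      rw [map_mul]
      rfl) hb' (fun x y => f (x.toMul, y.toMul))
    (fun x y w => by
      have h := (groupCohomology.mem_cocycles₂_iff _).1 f.2 x.toMul y.toMul w.toMul
      rw [htriv] at h
      exact h)
    (fun s => by
      have h := hx s
      rw [LHS.conjRep_H2π, groupCohomology.H2π_eq_iff] at h
      obtain ⟨e, he⟩ := h
      refine ⟨fun x => e x.toMul, fun x y => ?_⟩
      exact (hd e (x.toMul, y.toMul)).symm.trans (congrFun he (x.toMul, y.toMul)))
  have hz' : (fun p : N × N => z (.ofMul p.1) (.ofMul p.2)) ∈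
      groupCohomology.cocycles₂ (LHS.resN φ (LHS.inflate φ M)) := by
    rw [groupCohomology.mem_cocycles₂_iff]
    intro x y w
    rw [htriv]
    exact hz (.ofMul x) (.ofMul y) (.ofMul w)
  -- The last two cochains are taken to be zero on the nose, since `a` is already a cocycle in the
  -- `π` direction.
  refine ⟨⟨_, hz'⟩, fun s x => a s (.ofMul x), fun _ _ => 0, 0, ?_, fun s => ?_, fun s t => ?_,
    fun s t => (map_zero _).symm, map_zero _⟩
  · rw [groupCohomology.H2π_eq_iff]
    refine ⟨fun x => g (.ofMul x), funext fun p => ?_⟩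
    exact (hd _ p).trans (hg (.ofMul p.1) (.ofMul p.2))
  · exact funext fun p => (hd _ p).trans (ha s (.ofMul p.1) (.ofMul p.2))
  · exact funext fun x => (ha0 s t (.ofMul x)).symm

theorem proposition1 {N π : Type} [CommGroup N] [Module.Free ℤ (Additive N)]
    [Module.Finite ℤ (Additive N)] [Group π] (hπ : Nat.card π = 2) (φ : π →* MulAut N) :
    LHS.v2 ℤ φ = 0 ∧ ∀ M : Rep.{0} ℤ π, LHS.d2 φ (LHS.inflate φ M) = 0 := by
  exact ⟨DFunLike.congr_fun (d2_inflate_eq_zero hπ φ (LHS.H₂N ℤ φ)) _, d2_inflate_eq_zero hπ φ⟩
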